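/- Let $M\ge 1$ be an integer and let $0\le\rho_1\le\cdots\le\rho_{M-1}\le\rho_M=1$ be real numbers. For every integer $L\ge 1$ and $1\le j\le M$ put $r_j=r_j^{(L)}=\lfloor 2^{\rho_j L}\rfloor$, and let $\omega_r=e^{2\pi i/r}$. Let $p_k$ denote the $k$-th prime number ($p_1=2$), and put $$k^{(j)}_i=(M+j-1)2^L+i\qquad (1\le j\le M,\ 0\le i\le r_j-1).$$ Let $\Pi_L^\times$ be the set of all integers $$n=p_{k^{(1)}_{i_1}}p_{k^{(2)}_{i_2}}\cdots p_{k^{(M)}_{i_M}},\qquad 0\le i_j\le r_j-1 ;$$ each integer $n\ge1$ has at most one such representation, with at most one $L$. Let $$X=(\rho_1+\cdots+\rho_M)\,\frac{M+1}{2M},$$ let $\beta_1,\beta_2,\dots$ be any complex numbers with $|\beta_L|=1$, and define $$a_n=\begin{cases}\beta_L\,2^{-XL}\,\omega_{r_2}^{i_1i_2}\omega_{r_3}^{i_2i_3}\cdots\omega_{r_M}^{i_{M-1}i_M}&\text{if } n=p_{k^{(1)}_{i_1}}\cdots p_{k^{(M)}_{i_M}}\in\Pi_L^\times\text{ for some }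 L\ge 1,\\ 0&\text{otherwise.}\end{cases}$$ Then the Dirichlet series $f(s)=\sum_{n=1}^\infty a_n n^{-s}$ satisfies $\sigma_b\ge 0$, where $$\sigma_b=\inf\Big\{\sigma\in\mathbb R:\ \sum_{n=1}^\infty a_n n^{-s}\text{ converges to a bounded function on }\{s\in\mathbb C:\operatorname{Re}s>\sigma\}\Big\}.$$ -/

import Mathlib

open Filter Topology

noncomputable section

namespace DirichletWalsh

/-! ### Dirichlet series and the abscissa of boundedness -/

/-- The Dirichlet series `∑ a n * n ^ (-s)`, `n ≥ 1`, converges (possibly only conditionally) at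
every point of the open half plane `σ < re s`, and its sum is a bounded function there. -/
def ConvergesBoundedly (a : ℕ → ℂ) (σ : ℝ) : Prop :=
  ∃ (f : ℂ → ℂ) (C : ℝ), ∀ s : ℂ, σ < s.re →
    Tendsto (fun N : ℕ => ∑ n ∈ Finset.Icc 1 N, a n * (n : ℂ) ^ (-s)) atTop (𝓝 (f s)) ∧
      ‖f s‖ ≤ C

/-- The abscissa `σ_b`, as an extended real number: the infimum of all real `σ` such that the
Dirichlet series converges to a bounded function on the half plane `σ < re s`. -/
def sigmaB (a : ℕ → ℂ) : EReal :=
  sInf (Real.toEReal '' {σ : ℝ | ConvergesBoundedly a σ})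

/-! ### The construction

The index `j : Fin M` is the usual index `j ∈ {1, …, M}` shifted down by one. -/

/-- `r_j = ⌊2 ^ (ρ_j L)⌋`. -/
def size {M : ℕ} (ρ : Fin M → ℝ) (L : ℕ) (j : Fin M) : ℕ := ⌊(2 : ℝ) ^ (ρ j * L)⌋₊

/-- The `k`-th prime number, for `k ≥ 1`, so that `kthPrime 1 = 2`. -/
def kthPrime (k : ℕ) : ℕ := Nat.nth Nat.Prime (k - 1)

/-- The primitive root of unity `ω_r = exp (2 π i / r)`. -/
def rootOfUnity (r : ℕ) : ℂ := Complex.exp (2 * Real.pi * Complex.I / r)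

/-- The multi-indices `(i_1, …, i_M)` with `0 ≤ i_j < r_j`, at level `L`. -/
abbrev MultiIndex {M : ℕ} (ρ : Fin M → ℝ) (L : ℕ) : Type := (j : Fin M) → Fin (size ρ L j)

/-- The index of the prime chosen by the entry `i_j` of a multi-index: with `j` running from `1`
to `M` it is `(M + j - 1) 2 ^ L + i_j`. -/
def primeIndex {M : ℕ} (ρ : Fin M → ℝ) (L : ℕ) (i : MultiIndex ρ L) (j : Fin M) : ℕ :=
  (M + (j : ℕ)) * 2 ^ L + (i j : ℕ)

/-- The integer that belongs to a multi-index: the product over `j` of the primes with index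
`(M + j - 1) 2 ^ L + i_j`. -/
def primeProduct {M : ℕ} (ρ : Fin M → ℝ) (L : ℕ) (i : MultiIndex ρ L) : ℕ :=
  ∏ j : Fin M, kthPrime (primeIndex ρ L i j)

/-- The product of the roots of unity `ω_{r_j} ^ (i_{j-1} i_j)` over `j = 2, …, M`
(an empty product if `M = 1`). -/
def walshPhase {M : ℕ} (ρ : Fin M → ℝ) (L : ℕ) (i : MultiIndex ρ L) : ℂ :=
  ∏ j : Fin (M - 1),
    rootOfUnity (size ρ L ⟨(j : ℕ) + 1, by omega⟩) ^
      ((i ⟨(j : ℕ), by omega⟩ : ℕ) * (i ⟨(j : ℕ) + 1, by omega⟩ : ℕ))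

open Classical in
/-- The coefficients `a_n` of the series: if `n` is the integer of a multi-index at a level
`L ≥ 1`, then `a_n = β_L 2 ^ (-X L) ∏ ω_{r_j} ^ (i_{j-1} i_j)`, and otherwise `a_n = 0`.
The level and the multi-index are determined by `n`, see `primeProduct_inj`. -/
def coeff {M : ℕ} (ρ : Fin M → ℝ) (X : ℝ) (β : ℕ → ℂ) (n : ℕ) : ℂ :=
  if h : ∃ q : (L : ℕ) × MultiIndex ρ L, 1 ≤ q.1 ∧ primeProduct ρ q.1 q.2 = n then
    β h.choose.1 * (((2 : ℝ) ^ (-(X * (h.choose.1 : ℝ))) : ℝ) : ℂ) *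
      walshPhase ρ h.choose.1 h.choose.2
  else 0

/-! ### The coefficients are well defined -/

theorem size_le {M : ℕ} {ρ : Fin M → ℝ} (hρ : ∀ j, ρ j ≤ 1) (L : ℕ) (j : Fin M) :
    size ρ L j ≤ 2 ^ L := by
  have h : (2 : ℝ) ^ (ρ j * L) ≤ ((2 ^ L : ℕ) : ℝ) := by
    calc (2 : ℝ) ^ (ρ j * L) ≤ (2 : ℝ) ^ (L : ℝ) := by
          apply Real.rpow_le_rpow_of_exponent_le (by norm_num)
          have := mul_le_mul_of_nonneg_right (hρ j) (Nat.cast_nonneg (α := ℝ) L)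
          simpa using this
      _ = ((2 ^ L : ℕ) : ℝ) := by rw [Real.rpow_natCast]; push_cast; rfl
  exact Nat.floor_le_of_le h

theorem kthPrime_prime (k : ℕ) : (kthPrime k).Prime :=
  Nat.prime_nth_prime (k - 1)

theorem kthPrime_inj {k l : ℕ} (hk : 1 ≤ k) (hl : 1 ≤ l) (h : kthPrime k = kthPrime l) :
    k = l := by
  have := Nat.nth_injective Nat.infinite_setOfPred_prime h
  omega

theorem level_le {M L L' j j' x x' : ℕ} (hj : j < M) (hx : x < 2 ^ L)
    (h : (M + j) * 2 ^ L + x = (M + j') * 2 ^ L' + x') : L' ≤ L := by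
  by_contra hc
  have h1 : 2 ^ (L + 1) ≤ 2 ^ L' := Nat.pow_le_pow_right (by norm_num) (by omega)
  rw [pow_succ] at h1
  have h2 : (M + j + 1) * 2 ^ L ≤ (2 * M) * 2 ^ L := Nat.mul_le_mul_right _ (by omega)
  have h3 : M * (2 ^ L * 2) ≤ M * 2 ^ L' := Nat.mul_le_mul_left _ h1
  nlinarith [Nat.zero_le (j' * 2 ^ L')]

/-- Distinct levels or multi-indices give distinct integers. -/
theorem primeProduct_inj {M : ℕ} (hM : 1 ≤ M) {ρ : Fin M → ℝ} (hρ : ∀ j, ρ j ≤ 1)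
    (q q' : (L : ℕ) × MultiIndex ρ L)
    (h : primeProduct ρ q.1 q.2 = primeProduct ρ q'.1 q'.2) : q = q' := by
  obtain ⟨L, i⟩ := q
  obtain ⟨L', i'⟩ := q'
  simp only at h
  have hlt : ∀ (L : ℕ) (i : MultiIndex ρ L) (j : Fin M), (i j : ℕ) < 2 ^ L :=
    fun L i j => lt_of_lt_of_le (i j).2 (size_le hρ L j)
  have hpos : ∀ (L : ℕ) (i : MultiIndex ρ L) (j : Fin M), 1 ≤ primeIndex ρ L i j := by
    intro L i j
    have : 0 < (M + (j : ℕ)) * 2 ^ L := by positivity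
    unfold primeIndex
    omega
  have key : ∀ j : Fin M, ∃ j' : Fin M, primeIndex ρ L i j = primeIndex ρ L' i' j' := by
    intro j
    have hd : kthPrime (primeIndex ρ L i j) ∣ primeProduct ρ L' i' := by
      rw [← h]
      exact Finset.dvd_prod_of_mem _ (Finset.mem_univ j)
    obtain ⟨j', -, hj'⟩ := (kthPrime_prime _).prime.exists_mem_finset_dvd hd
    exact ⟨j', kthPrime_inj (hpos _ _ _) (hpos _ _ _)
      ((Nat.prime_dvd_prime_iff_eq (kthPrime_prime _) (kthPrime_prime _)).1 hj')⟩
  obtain ⟨j', h0⟩ := key ⟨0, hM⟩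
  have hL : L = L' :=
    le_antisymm (level_le j'.2 (hlt L' i' j') h0.symm) (level_le hM (hlt L i ⟨0, hM⟩) h0)
  subst hL
  congr 1
  funext j
  obtain ⟨j', hj⟩ := key j
  unfold primeIndex at hj
  have h1 := hlt L i j
  have h2 := hlt L i' j'
  have hjj : (j : ℕ) = j' := by
    have e1 : ((M + (j : ℕ)) * 2 ^ L + (i j : ℕ)) / 2 ^ L = M + j := by
      rw [mul_comm, Nat.mul_add_div (by positivity), Nat.div_eq_of_lt h1, add_zero]
    have e2 : ((M + (j' : ℕ)) * 2 ^ L + (i' j' : ℕ)) / 2 ^ L = M + j' := by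
      rw [mul_comm, Nat.mul_add_div (by positivity), Nat.div_eq_of_lt h2, add_zero]
    rw [hj, e2] at e1
    omega
  have hjj' : j = j' := Fin.ext hjj
  subst hjj'
  apply Fin.ext
  omega

/-- The defining formula of the coefficients, free of choices. -/
theorem coeff_primeProduct {M : ℕ} (hM : 1 ≤ M) {ρ : Fin M → ℝ} (hρ : ∀ j, ρ j ≤ 1) (X : ℝ)
    (β : ℕ → ℂ) {L : ℕ} (hL : 1 ≤ L) (i : MultiIndex ρ L) :
    coeff ρ X β (primeProduct ρ L i) =
      β L * (((2 : ℝ) ^ (-(X * (L : ℝ))) : ℝ) : ℂ) * walshPhase ρ L i := by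
  have h : ∃ q : (L : ℕ) × MultiIndex ρ L,
      1 ≤ q.1 ∧ primeProduct ρ q.1 q.2 = primeProduct ρ L i := ⟨⟨L, i⟩, hL, rfl⟩
  have hq : h.choose = ⟨L, i⟩ := primeProduct_inj hM hρ _ _ h.choose_spec.2
  unfold coeff
  rw [dif_pos h, hq]

theorem coeff_eq_zero {M : ℕ} (ρ : Fin M → ℝ) (X : ℝ) (β : ℕ → ℂ) {n : ℕ}
    (h : ∀ L, 1 ≤ L → ∀ i : MultiIndex ρ L, primeProduct ρ L i ≠ n) : coeff ρ X β n = 0 := by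
  unfold coeff
  rw [dif_neg]
  rintro ⟨⟨L, i⟩, hL, hn⟩
  exact h L hL i hn

end DirichletWalsh

end

/-! Suppose the series converges with sum bounded by `C` on a half plane `σ < re s` with `σ < 0`.
Two bounds for the multilinear form attached to level `L`, with coefficients `walshPhase`, then
contradict each other as `L` grows.

Upper bound: averaging `f` on a vertical line against a nonnegative trigonometric polynomial of mean
1 gives at most `C`. A Riesz product over the level-`L` primes is such a polynomial, and by unique
factorization the only nonzero coefficients it picks out are those of level `L`
(`norm_sum_rieszWeight_le`, `norm_sum_coeff_primeProduct_le`). On the line `re s = -δ` each prime `p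
≥ 2 ^ L` contributes `p ^ δ`, so the form gains a factor `2 ^ (δ M L)`
(`norm_sum_walshPhase_mul_le`).

Lower bound: for any unimodular coefficients, Khinchine's inequality in all variables but the last
and a choice of phases in the last make the form at least `4 ^ (-(M - 1)) r_M ∏ √r_j`, with the
product over `j < M` (`exists_unit_weights_norm_sum_ge`). Up to a constant this is `2 ^ (L (1 + S /
2))` with `S = ρ_1 + ⋯ + ρ_{M-1}`, and `X ≤ 1 + S / 2`. Hence `2 ^ (δ M L)` would stay bounded in
`L`. -/

/-! ### Holomorphy of convergent Dirichlet series -/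

/-- The mean value theorem for `x ↦ x ^ (-w)`. -/
theorem norm_natCast_cpow_sub_le {n : ℕ} (hn : n ≠ 0) {w : ℂ} (hw : 0 < w.re) :
    ‖(n : ℂ) ^ (-w) - ((n + 1 : ℕ) : ℂ) ^ (-w)‖ ≤ ‖w‖ * (n : ℝ) ^ (-w.re - 1) := by
  have hn0 : (0 : ℝ) < n := by exact_mod_cast Nat.pos_of_ne_zero hn
  have hw0 : -w ≠ 0 := by
    intro h
    rw [neg_eq_zero] at h
    simp [h] at hw
  have key := norm_image_sub_le_of_norm_deriv_le_segment' (a := (n : ℝ)) (b := n + 1)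
    (f := fun x : ℝ => (x : ℂ) ^ (-w)) (f' := fun x : ℝ => (-w) * (x : ℂ) ^ (-w - 1))
    (C := ‖w‖ * (n : ℝ) ^ (-w.re - 1))
    (fun x hx => (hasDerivAt_ofReal_cpow_const (hn0.trans_le hx.1).ne' hw0).hasDerivWithinAt)
    (fun x hx => by
      have hx0 : 0 < x := by linarith [hx.1]
      rw [norm_mul, norm_neg, Complex.norm_cpow_eq_rpow_re_of_pos hx0]
      refine mul_le_mul_of_nonneg_left ?_ (norm_nonneg _)
      simp only [Complex.sub_re, Complex.neg_re, Complex.one_re]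
      exact Real.rpow_le_rpow_of_nonpos hn0 hx.1 (by linarith))
    (n + 1) ⟨by linarith, le_rfl⟩
  rw [norm_sub_rev]
  simpa using key

/-- Summation by parts for the partial sums of a Dirichlet series. -/
theorem sum_Icc_mul_cpow_eq (b : ℕ → ℂ) (w : ℂ) (N : ℕ) :
    ∑ n ∈ Finset.Icc 1 N, b n * (n : ℂ) ^ (-w) =
      (∑ n ∈ Finset.Icc 1 N, b n) * ((N + 1 : ℕ) : ℂ) ^ (-w) +
        ∑ n ∈ Finset.range (N + 1), (∑ m ∈ Finset.Icc 1 n, b m) *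
          ((n : ℂ) ^ (-w) - ((n + 1 : ℕ) : ℂ) ^ (-w)) := by
  induction N with
  | zero => simp
  | succ N ih =>
    rw [Finset.sum_range_succ, Finset.sum_Icc_succ_top (by omega), ih,
      Finset.sum_Icc_succ_top (by omega)]
    ring

/-- A convergent Dirichlet series is holomorphic. -/
theorem differentiableOn_of_tendsto_dirichletSeries {a : ℕ → ℂ} {σ : ℝ} {f : ℂ → ℂ}
    (h : ∀ s : ℂ, σ < s.re →
      Tendsto (fun N : ℕ => ∑ n ∈ Finset.Icc 1 N, a n * (n : ℂ) ^ (-s)) atTop (𝓝 (f s))) :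
    DifferentiableOn ℂ f {s | σ < s.re} := by
  intro s₁ hs₁
  simp only [Set.mem_ofPred_eq] at hs₁
  -- Here `re s₁ = σ + 4δ`; with the base point at `σ + 2δ` and a ball of radius `δ` about `s₁`, `re
  -- (s - s₀) > δ` on the ball. The series summed by parts is therefore dominated by a multiple of
  -- `n ^ (-δ - 1)`, although the original series need not converge absolutely.
  set δ : ℝ := (s₁.re - σ) / 4 with hδ
  have hδ0 : 0 < δ := by linarith
  set s₀ : ℂ := ((σ + 2 * δ : ℝ) : ℂ) with hs₀
  have hs₀re : s₀.re = σ + 2 * δ := by simp [hs₀]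
  let b : ℕ → ℂ := fun n => a n * (n : ℂ) ^ (-s₀)
  let A : ℕ → ℂ := fun N => ∑ n ∈ Finset.Icc 1 N, b n
  have hA : Tendsto A atTop (𝓝 (f s₀)) := h s₀ (by rw [hs₀re]; linarith)
  obtain ⟨B, hB⟩ : ∃ B, ∀ N, ‖A N‖ ≤ B := by
    obtain ⟨B, hB⟩ := (Metric.isBounded_range_of_tendsto A hA).exists_norm_le
    exact ⟨B, fun N => hB _ ⟨N, rfl⟩⟩
  let U : Set ℂ := Metric.ball s₁ δ
  let F : ℕ → ℂ → ℂ := fun n s => A n * ((n : ℂ) ^ (-(s - s₀)) - ((n + 1 : ℕ) : ℂ) ^ (-(s - s₀)))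
  set R : ℝ := ‖s₁ - s₀‖ + δ with hR
  have hre : ∀ s ∈ U, δ < (s - s₀).re ∧ ‖s - s₀‖ ≤ R ∧ σ < s.re := by
    intro s hs
    have h1 : ‖s - s₁‖ < δ := by simpa [U, dist_eq_norm] using hs
    have h2 := (abs_lt.1 ((Complex.abs_re_le_norm (s - s₁)).trans_lt h1)).1
    simp only [Complex.sub_re] at h2 ⊢
    refine ⟨by rw [hs₀re]; linarith, ?_, by linarith⟩
    calc ‖s - s₀‖ = ‖(s - s₁) + (s₁ - s₀)‖ := by ring_nf
      _ ≤ ‖s - s₁‖ + ‖s₁ - s₀‖ := norm_add_le _ _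
      _ ≤ R := by rw [hR]; linarith
  let u : ℕ → ℝ := fun n => B * (R * (n : ℝ) ^ (-δ - 1))
  have hB0 : 0 ≤ B := (norm_nonneg _).trans (hB 0)
  have hR0 : 0 ≤ R := by positivity
  have hu : Summable u :=
    ((Real.summable_nat_rpow.2 (by linarith)).mul_left R).mul_left B
  have hFu : ∀ n s, s ∈ U → ‖F n s‖ ≤ u n := by
    intro n s hs
    obtain ⟨h1, h2, -⟩ := hre s hs
    rcases Nat.eq_zero_or_pos n with rfl | hn
    · simp only [F, A, u]
      simpa using by positivity
    · rw [norm_mul]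
      refine mul_le_mul (hB n) ?_ (norm_nonneg _) hB0
      refine (norm_natCast_cpow_sub_le hn.ne' (by linarith)).trans ?_
      refine mul_le_mul h2 ?_ (by positivity) hR0
      exact Real.rpow_le_rpow_of_exponent_le (by exact_mod_cast hn) (by linarith)
  have hFd : ∀ n, DifferentiableOn ℂ (F n) U := by
    intro n s hs
    refine DifferentiableAt.differentiableWithinAt ?_
    obtain ⟨h1, -, -⟩ := hre s hs
    have hne : -(s - s₀) ≠ 0 := by
      intro h0
      rw [neg_eq_zero] at h0
      rw [h0] at h1
      simp at h1
      linarith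
    refine DifferentiableAt.const_mul (DifferentiableAt.sub ?_ ?_) _
    · exact DifferentiableAt.const_cpow (by fun_prop) (Or.inr hne)
    · exact DifferentiableAt.const_cpow (by fun_prop) (Or.inr hne)
  have hd := Complex.differentiableOn_tsum_of_summable_norm hu hFd Metric.isOpen_ball hFu
  have heq : ∀ s ∈ U, f s = ∑' n, F n s := by
    intro s hs
    obtain ⟨h1, -, h3⟩ := hre s hs
    have hsum : Summable (fun n => F n s) :=
      Summable.of_norm_bounded hu (fun n => hFu n s hs)
    have ht := hsum.hasSum.tendsto_sum_nat.comp (tendsto_add_atTop_nat 1)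
    have hz : Tendsto (fun N : ℕ => ((N + 1 : ℕ) : ℂ) ^ (-(s - s₀))) atTop (𝓝 0) := by
      rw [tendsto_zero_iff_norm_tendsto_zero]
      have : ∀ N : ℕ, ‖((N + 1 : ℕ) : ℂ) ^ (-(s - s₀))‖ = ((N + 1 : ℕ) : ℝ) ^ (-(s - s₀).re) := by
        intro N
        rw [Complex.norm_natCast_cpow_of_pos (by omega), Complex.neg_re]
      simp only [this]
      exact ((tendsto_rpow_neg_atTop (by linarith)).comp tendsto_natCast_atTop_atTop).comp
        (tendsto_add_atTop_nat 1)
    have hlim := (hA.mul hz).add ht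
    rw [mul_zero, zero_add] at hlim
    refine tendsto_nhds_unique (h s h3) (hlim.congr fun N => ?_)
    have := sum_Icc_mul_cpow_eq b (s - s₀) N
    simp only [Function.comp_apply]
    rw [← this]
    refine Finset.sum_congr rfl fun n hn => ?_
    have hn0 : (n : ℂ) ≠ 0 := by
      have := (Finset.mem_Icc.1 hn).1
      exact_mod_cast (by omega : n ≠ 0)
    simp only [b]
    rw [mul_assoc, ← Complex.cpow_add _ _ hn0]
    congr 2
    ring
  have hd' : DifferentiableOn ℂ f U := hd.congr heq
  exact (hd'.differentiableAt (Metric.ball_mem_nhds s₁ hδ0)).differentiableWithinAt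

/-! ### Mean values on vertical lines -/

/-- Orthogonality of the characters `t ↦ x ^ (i t)`: for `x ≠ 1` the primitive is bounded, so the
factor `1 / (2 T)` kills it. -/
theorem tendsto_mean_cpow {x : ℝ} (hx : 0 < x) :
    Tendsto (fun T : ℝ => (1 / (2 * T) : ℂ) * ∫ t in -T..T, (x : ℂ) ^ (t * Complex.I))
      atTop (𝓝 (if x = 1 then 1 else 0)) := by
  split_ifs with h
  · subst h
    refine tendsto_const_nhds.congr' ?_
    filter_upwards [eventually_gt_atTop 0] with T hT
    have : (T : ℂ) ≠ 0 := by exact_mod_cast hT.ne'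
    simp
    field_simp
    norm_num
  · have hl : Real.log x ≠ 0 := Real.log_ne_zero_of_pos_of_ne_one hx h
    set c : ℂ := Real.log x * Complex.I with hc
    have hc0 : c ≠ 0 := by simp [hc, hl]
    have hcp : ∀ t : ℝ, (x : ℂ) ^ (t * Complex.I) = Complex.exp (c * t) := by
      intro t
      rw [Complex.cpow_def_of_ne_zero (by exact_mod_cast hx.ne'), ← Complex.ofReal_log hx.le, hc]
      ring_nf
    have hn : ∀ t : ℝ, ‖Complex.exp (c * t)‖ = 1 := by
      intro t
      rw [hc, show (Real.log x : ℂ) * Complex.I * t = ((Real.log x * t : ℝ) : ℂ) * Complex.I by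
        push_cast; ring]
      exact Complex.norm_exp_ofReal_mul_I _
    simp only [hcp, integral_exp_mul_complex hc0]
    apply squeeze_zero_norm' (a := fun T : ℝ => (1 / ‖c‖) * T⁻¹)
    · filter_upwards [eventually_gt_atTop 0] with T hT
      rw [norm_mul, norm_div, norm_div]
      have h2 : ‖Complex.exp (c * T) - Complex.exp (c * ((-T : ℝ) : ℂ))‖ ≤ 2 := by
        refine (norm_sub_le _ _).trans ?_
        rw [hn, hn]; norm_num
      have hcn : 0 < ‖c‖ := norm_pos_iff.2 hc0
      have h3 : ‖(2 * T : ℂ)‖ = 2 * T := by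
        rw [norm_mul, Complex.norm_real, Real.norm_of_nonneg hT.le]; norm_num
      rw [h3, norm_one]
      calc 1 / (2 * T) * (‖Complex.exp (c * T) - Complex.exp (c * ((-T : ℝ) : ℂ))‖ / ‖c‖)
          ≤ 1 / (2 * T) * (2 / ‖c‖) := by gcongr
        _ = 1 / ‖c‖ * T⁻¹ := by field_simp
    · simpa using tendsto_inv_atTop_zero.const_mul (1 / ‖c‖)

/-- The mean values of an absolutely convergent Dirichlet series on a vertical line are its
coefficients. -/
theorem tendsto_mean_dirichletSeries_of_summable {a : ℕ → ℂ} (ha : a 0 = 0) {c : ℝ}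
    (hs : Summable fun n : ℕ => ‖a n‖ * (n : ℝ) ^ (-c)) {x : ℝ} (hx : 0 < x) :
    Tendsto (fun T : ℝ => (1 / (2 * T) : ℂ) * ∫ t in -T..T,
      (∑' n : ℕ, a n * (n : ℂ) ^ (-(c + t * Complex.I))) * (x : ℂ) ^ (c + t * Complex.I))
      atTop (𝓝 (∑' n : ℕ, if (n : ℝ) = x then a n else 0)) := by
  have hx0 : (x : ℂ) ≠ 0 := by exact_mod_cast hx.ne'
  let G : ℕ → ℝ → ℂ := fun n t => a n * ((n : ℂ) ^ (-(c + t * Complex.I)) *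
    (x : ℂ) ^ (c + t * Complex.I))
  let bd : ℕ → ℝ := fun n => ‖a n‖ * (n : ℝ) ^ (-c) * x ^ c
  have hbd : Summable bd := hs.mul_right _
  have hG : ∀ n t, ‖G n t‖ ≤ bd n := by
    intro n t
    rcases Nat.eq_zero_or_pos n with rfl | hn
    · simp [G, bd, ha]
    · simp only [G, bd, norm_mul]
      rw [Complex.norm_natCast_cpow_of_pos hn, Complex.norm_cpow_eq_rpow_re_of_pos hx]
      simp [mul_assoc]
  -- As `n ^ (-s) * x ^ s = (x / n) ^ s`, the mean of the `n`-th term survives only for `n = x`;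
  -- dominated convergence handles the sum.
  have hGeq : ∀ n : ℕ, n ≠ 0 → ∀ t : ℝ, G n t = a n * ((x / n : ℝ) : ℂ) ^ (c : ℂ) *
      ((x / n : ℝ) : ℂ) ^ (t * Complex.I) := by
    intro n hn t
    have hn0 : (0 : ℝ) < n := by exact_mod_cast Nat.pos_of_ne_zero hn
    have hxn : ((x / n : ℝ) : ℂ) ≠ 0 := by exact_mod_cast (div_pos hx hn0).ne'
    rw [mul_assoc, ← Complex.cpow_add _ _ hxn]
    simp only [G]
    congr 1
    rw [div_eq_mul_inv, Complex.ofReal_mul, Complex.mul_cpow_ofReal_nonneg hx.le (by positivity),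
      Complex.cpow_neg, mul_comm, Complex.ofReal_inv, Complex.ofReal_natCast, Complex.inv_cpow]
    rw [Complex.natCast_arg]
    exact Real.pi_ne_zero.symm
  have hGc : ∀ n, Continuous (G n) := by
    intro n
    rcases Nat.eq_zero_or_pos n with rfl | hn
    · simp only [G, ha, zero_mul]; exact continuous_const
    · have : (n : ℂ) ≠ 0 := by exact_mod_cast hn.ne'
      simp only [G]
      refine continuous_const.mul (Continuous.mul ?_ ?_)
      · exact Continuous.const_cpow (by fun_prop) (Or.inl this)
      · exact Continuous.const_cpow (by fun_prop) (Or.inl hx0)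
  have hint : ∀ T : ℝ, ∫ t in -T..T, (∑' n : ℕ, a n * (n : ℂ) ^ (-(c + t * Complex.I))) *
      (x : ℂ) ^ (c + t * Complex.I) = ∑' n, ∫ t in -T..T, G n t := by
    intro T
    refine (HasSum.tsum_eq (intervalIntegral.hasSum_integral_of_dominated_convergence
      (fun n _ => bd n) (fun n => (hGc n).aestronglyMeasurable)
      (fun n => Eventually.of_forall fun t _ => hG n t)
      (Eventually.of_forall fun t _ => hbd) (intervalIntegrable_const)
      (Eventually.of_forall fun t _ => ?_))).symm
    have : Summable fun n => G n t := Summable.of_norm_bounded hbd (fun n => hG n t)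
    have h1 := this.hasSum
    simp only [G, ← mul_assoc, tsum_mul_right] at h1
    simpa only [G, ← mul_assoc] using h1
  simp only [hint, ← tsum_mul_left]
  refine tendsto_tsum_of_dominated_convergence hbd (fun n => ?_) ?_
  · rcases Nat.eq_zero_or_pos n with rfl | hn
    · simp [G, ha]
    · have hn0 : (0 : ℝ) < n := by exact_mod_cast hn
      have h1 := (tendsto_mean_cpow (div_pos hx hn0)).const_mul
        (a n * ((x / n : ℝ) : ℂ) ^ (c : ℂ))
      have h2 : (a n * ((x / n : ℝ) : ℂ) ^ (c : ℂ)) * (if x / n = 1 then (1 : ℂ) else 0) =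
          if (n : ℝ) = x then a n else 0 := by
        have : x / n = 1 ↔ (n : ℝ) = x := by
          rw [div_eq_one_iff_eq hn0.ne']; exact eq_comm
        simp only [this]
        split_ifs with h
        · rw [h, div_self hx.ne']; simp
        · simp
      rw [h2] at h1
      refine h1.congr fun T => ?_
      simp only [hGeq n hn.ne', intervalIntegral.integral_const_mul]
      ring
  · filter_upwards [eventually_gt_atTop 0] with T hT n
    have h1 := intervalIntegral.norm_integral_le_of_norm_le_const (a := -T) (b := T)
      (C := bd n) (f := G n) (fun t _ => hG n t)
    rw [norm_mul, norm_div, norm_one, norm_mul, Complex.norm_real, Real.norm_of_nonneg hT.le]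
    rw [sub_neg_eq_add, abs_of_pos (by linarith)] at h1
    calc 1 / (‖(2 : ℂ)‖ * T) * ‖∫ t in -T..T, G n t‖ ≤ 1 / (‖(2 : ℂ)‖ * T) * (bd n * (T + T)) := by
          gcongr
      _ = bd n := by
          rw [Complex.norm_ofNat]
          field_simp
          ring

/-- The mean values of a bounded holomorphic function times `x ^ s` on two vertical lines
agree. -/
theorem tendsto_mean_sub_mean {g : ℂ → ℂ} {κ c B : ℝ} (hκc : κ ≤ c)
    (hg : DifferentiableOn ℂ g {s | κ ≤ s.re}) (hB : ∀ s : ℂ, κ ≤ s.re → s.re ≤ c → ‖g s‖ ≤ B) :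
    Tendsto (fun T : ℝ => (1 / (2 * T) : ℂ) * (∫ t in -T..T, g (κ + t * Complex.I)) -
      (1 / (2 * T) : ℂ) * ∫ t in -T..T, g (c + t * Complex.I)) atTop (𝓝 0) := by
  apply squeeze_zero_norm' (a := fun T : ℝ => (B * (c - κ)) * T⁻¹)
  · filter_upwards [eventually_gt_atTop 0] with T hT
    -- Cauchy's theorem on a rectangle of height `2 T`: the horizontal sides contribute at most `B *
    -- (c - κ)` each, independently of `T`.
    have key := Complex.integral_boundary_rect_eq_zero_of_differentiableOn g
      (κ - T * Complex.I) (c + T * Complex.I) (hg.mono (by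
        intro s hs
        rw [Complex.mem_reProdIm] at hs
        have h1 := hs.1
        simp [Set.uIcc_of_le hκc] at h1
        exact h1.1))
    simp only [Complex.sub_re, Complex.ofReal_re, Complex.mul_re, Complex.I_re, mul_zero,
      Complex.ofReal_im, Complex.I_im, mul_one, sub_self, sub_zero, Complex.add_re, add_zero,
      Complex.sub_im, Complex.mul_im, zero_sub, Complex.add_im, zero_add, smul_eq_mul] at key
    have hhor : ∀ y : ℝ, ‖∫ u in κ..c, g (u + y * Complex.I)‖ ≤ B * (c - κ) := by
      intro y
      have := intervalIntegral.norm_integral_le_of_norm_le_const (a := κ) (b := c)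
        (C := B) (f := fun u : ℝ => g (u + y * Complex.I)) (fun u hu => by
          rw [Set.uIoc_of_le hκc] at hu
          exact hB _ (by simpa using hu.1.le) (by simpa using hu.2))
      rwa [abs_of_nonneg (by linarith)] at this
    set I₁ := ∫ u in κ..c, g (u + ((-T : ℝ) : ℂ) * Complex.I) with hI₁
    set I₂ := ∫ u in κ..c, g (u + (T : ℂ) * Complex.I)
    set V₁ := ∫ t in -T..T, g (κ + t * Complex.I)
    set V₂ := ∫ t in -T..T, g (c + t * Complex.I)
    have hV : Complex.I * (V₁ - V₂) = I₁ - I₂ := by linear_combination -key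
    have hVn : ‖V₁ - V₂‖ ≤ 2 * (B * (c - κ)) := by
      have : ‖Complex.I * (V₁ - V₂)‖ = ‖V₁ - V₂‖ := by simp
      rw [← this, hV]
      refine (norm_sub_le _ _).trans ?_
      have h1 := hhor (-T)
      have h2 := hhor T
      linarith
    rw [← mul_sub, norm_mul, norm_div, norm_one, norm_mul, Complex.norm_real,
      Real.norm_of_nonneg hT.le, Complex.norm_ofNat]
    calc 1 / (2 * T) * ‖V₁ - V₂‖ ≤ 1 / (2 * T) * (2 * (B * (c - κ))) := by gcongr
      _ = B * (c - κ) * T⁻¹ := by field_simp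
  · simpa using tendsto_inv_atTop_zero.const_mul (B * (c - κ))

/-- The mean values of a bounded Dirichlet series on a vertical line are its coefficients. -/
theorem tendsto_mean_dirichletSeries {a : ℕ → ℂ} (ha : a 0 = 0) {σ C : ℝ} {f : ℂ → ℂ}
    (h : ∀ s : ℂ, σ < s.re →
      Tendsto (fun N : ℕ => ∑ n ∈ Finset.Icc 1 N, a n * (n : ℂ) ^ (-s)) atTop (𝓝 (f s)) ∧
        ‖f s‖ ≤ C) {κ : ℝ} (hκ : σ < κ) {x : ℝ} (hx : 0 < x) :
    Tendsto (fun T : ℝ => (1 / (2 * T) : ℂ) * ∫ t in -T..T,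
      f (κ + t * Complex.I) * (x : ℂ) ^ (κ + t * Complex.I))
      atTop (𝓝 (∑' n : ℕ, if (n : ℝ) = x then a n else 0)) := by
  have hx0 : (x : ℂ) ≠ 0 := by exact_mod_cast hx.ne'
  have hf := differentiableOn_of_tendsto_dirichletSeries fun s hs => (h s hs).1
  -- Convergence at `κ` bounds the terms there, so moving right by 2 gives absolute convergence. The
  -- mean is computed on `re s = c` and carried back to `re s = κ`.
  set c : ℝ := κ + 2 with hc
  have hsum : Summable fun n : ℕ => ‖a n‖ * (n : ℝ) ^ (-c) := by
    have ht := (h (κ : ℂ) (by simpa using hκ)).1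
    obtain ⟨B, hB⟩ := (Metric.isBounded_range_of_tendsto _ ht).exists_norm_le
    have hB' : ∀ N : ℕ, ‖∑ n ∈ Finset.Icc 1 N, a n * (n : ℂ) ^ (-(κ : ℂ))‖ ≤ B :=
      fun N => hB _ ⟨N, rfl⟩
    refine Summable.of_nonneg_of_le (fun n => by positivity) (fun n => ?_)
      ((Real.summable_nat_rpow.2 (by norm_num : (-2 : ℝ) < -1)).mul_left (2 * B))
    rcases Nat.eq_zero_or_pos n with rfl | hn
    · simp [ha]
    · obtain ⟨m, rfl⟩ : ∃ m, n = m + 1 := ⟨n - 1, by omega⟩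
      have hn0 : (0 : ℝ) < ((m + 1 : ℕ) : ℝ) := by positivity
      have h1 : a (m + 1) * ((m + 1 : ℕ) : ℂ) ^ (-(κ : ℂ)) =
          (∑ n ∈ Finset.Icc 1 (m + 1), a n * (n : ℂ) ^ (-(κ : ℂ))) -
            ∑ n ∈ Finset.Icc 1 m, a n * (n : ℂ) ^ (-(κ : ℂ)) := by
        rw [Finset.sum_Icc_succ_top (by omega)]; ring
      have h2 : ‖a (m + 1)‖ * ((m + 1 : ℕ) : ℝ) ^ (-κ) ≤ 2 * B := by
        have : ‖a (m + 1) * ((m + 1 : ℕ) : ℂ) ^ (-(κ : ℂ))‖ =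
            ‖a (m + 1)‖ * ((m + 1 : ℕ) : ℝ) ^ (-κ) := by
          rw [norm_mul, Complex.norm_natCast_cpow_of_pos hn]; simp
        rw [← this, h1]
        refine (norm_sub_le _ _).trans ?_
        linarith [hB' m, hB' (m + 1)]
      rw [show -c = -κ + -2 by rw [hc]; ring, Real.rpow_add hn0, ← mul_assoc]
      exact mul_le_mul_of_nonneg_right h2 (by positivity)
  have hfc : ∀ t : ℝ, f (c + t * Complex.I) =
      ∑' n : ℕ, a n * (n : ℂ) ^ (-(c + t * Complex.I)) := by
    intro t
    have hs : Summable fun n : ℕ => a n * (n : ℂ) ^ (-(c + t * Complex.I)) := by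
      refine Summable.of_norm_bounded hsum fun n => ?_
      rcases Nat.eq_zero_or_pos n with rfl | hn
      · simp [ha]
      · rw [norm_mul, Complex.norm_natCast_cpow_of_pos hn]; simp
    refine tendsto_nhds_unique (h _ (by simp [hc]; linarith)).1
      ((hs.hasSum.tendsto_sum_nat.comp (tendsto_add_atTop_nat 1)).congr fun N => ?_)
    simp only [Function.comp_apply]
    rw [Finset.range_eq_Ico, Finset.sum_eq_sum_Ico_succ_bot (by omega), ha, zero_mul, zero_add]
    rfl
  have h1 := tendsto_mean_dirichletSeries_of_summable ha hsum hx
  simp only [← hfc] at h1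
  obtain ⟨B, hB⟩ : ∃ B, ∀ s : ℂ, κ ≤ s.re → s.re ≤ c → ‖f s * (x : ℂ) ^ s‖ ≤ B := by
    refine ⟨C * max (x ^ κ) (x ^ c), fun s hs hs' => ?_⟩
    rw [norm_mul, Complex.norm_cpow_eq_rpow_re_of_pos hx]
    have hfs := (h s (by linarith)).2
    refine mul_le_mul hfs ?_ (by positivity) ((norm_nonneg _).trans hfs)
    rcases le_total 1 x with h1 | h1
    · exact le_max_of_le_right (Real.rpow_le_rpow_of_exponent_le h1 hs')
    · exact le_max_of_le_left (Real.rpow_le_rpow_of_exponent_ge hx h1 hs)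
  have h2 := tendsto_mean_sub_mean (g := fun s => f s * (x : ℂ) ^ s) (κ := κ) (c := c)
    (by linarith) ((hf.mono fun s hs => hκ.trans_le hs).mul
      (DifferentiableOn.const_cpow differentiableOn_id (Or.inl hx0))) hB
  simpa using h2.add h1

/-- A bounded Dirichlet series tested against a nonnegative generalized trigonometric
polynomial. -/
theorem norm_sum_mul_tsum_le_of_nonneg {a : ℕ → ℂ} (ha : a 0 = 0) {σ C : ℝ} {f : ℂ → ℂ}
    (h : ∀ s : ℂ, σ < s.re →
      Tendsto (fun N : ℕ => ∑ n ∈ Finset.Icc 1 N, a n * (n : ℂ) ^ (-s)) atTop (𝓝 (f s)) ∧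
        ‖f s‖ ≤ C) {κ : ℝ} (hκ : σ < κ) {ι : Type*} [Fintype ι] (c : ι → ℂ) (x : ι → ℝ)
    (hx : ∀ e, 0 < x e) (G : ℝ → ℝ) (hG0 : ∀ t, 0 ≤ G t)
    (hG : ∀ t : ℝ, (G t : ℂ) = ∑ e, c e * (x e : ℂ) ^ (t * Complex.I)) :
    ‖∑ e, c e * ((x e : ℂ) ^ (-(κ : ℂ)) * ∑' n : ℕ, if (n : ℝ) = x e then a n else 0)‖ ≤
      C * ‖∑ e, c e * if x e = 1 then 1 else 0‖ := by
  have hx0 : ∀ e, (x e : ℂ) ≠ 0 := fun e => by exact_mod_cast (hx e).ne'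
  have hf := differentiableOn_of_tendsto_dirichletSeries fun s hs => (h s hs).1
  have hfc : Continuous fun t : ℝ => f (κ + t * Complex.I) := by
    have := hf.continuousOn.comp_continuous (f := fun t : ℝ => (κ + t * Complex.I : ℂ))
      (by fun_prop) (fun t => by simpa using hκ)
    exact this
  have hGc : Continuous fun t : ℝ => (G t : ℂ) := by
    simp only [hG]
    refine continuous_finsetSum _ fun e _ => continuous_const.mul ?_
    exact Continuous.const_cpow (by fun_prop) (Or.inl (hx0 e))
  have hGr : Continuous G := by
    have := Complex.continuous_re.comp hGc
    simpa [Function.comp_def] using this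
  -- Both sides of the claim are limits of means: the left of `f * G`, since `x ^ (-κ)` cancels the
  -- modulus of `x ^ (κ + i t)`, the right of `C * G`. For each `T` they compare because `G ≥ 0`.
  have hL := tendsto_finsetSum (Finset.univ : Finset ι) fun e _ =>
    ((tendsto_mean_dirichletSeries ha h hκ (hx e)).const_mul ((x e : ℂ) ^ (-(κ : ℂ)))).const_mul (c e)
  have hR := tendsto_finsetSum (Finset.univ : Finset ι) fun e _ =>
    (tendsto_mean_cpow (hx e)).const_mul (c e)
  refine le_of_tendsto_of_tendsto hL.norm (hR.norm.const_mul C) ?_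
  filter_upwards [eventually_gt_atTop 0] with T hT
  have e1 : ∑ e, c e * ((x e : ℂ) ^ (-(κ : ℂ)) * ((1 / (2 * T) : ℂ) * ∫ t in -T..T,
      f (κ + t * Complex.I) * (x e : ℂ) ^ (κ + t * Complex.I))) =
      (1 / (2 * T) : ℂ) * ∫ t in -T..T, f (κ + t * Complex.I) * (G t : ℂ) := by
    simp only [hG, Finset.mul_sum]
    rw [intervalIntegral.integral_finsetSum, Finset.mul_sum]
    · refine Finset.sum_congr rfl fun e _ => ?_
      rw [← mul_assoc, ← mul_assoc, mul_comm _ (1 / (2 * T) : ℂ), mul_assoc (1 / (2 * T) : ℂ),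
        ← intervalIntegral.integral_const_mul]
      congr 1
      refine intervalIntegral.integral_congr fun t _ => ?_
      rw [Complex.cpow_add _ _ (hx0 e), Complex.cpow_neg]
      have : (x e : ℂ) ^ (κ : ℂ) ≠ 0 := by simp [Complex.cpow_eq_zero_iff, hx0 e]
      field_simp
    · intro e _
      refine Continuous.intervalIntegrable (hfc.mul (continuous_const.mul ?_)) _ _
      exact Continuous.const_cpow (by fun_prop) (Or.inl (hx0 e))
  have e2 : ∑ e, c e * ((1 / (2 * T) : ℂ) * ∫ t in -T..T, (x e : ℂ) ^ (t * Complex.I)) =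
      (1 / (2 * T) : ℂ) * ∫ t in -T..T, (G t : ℂ) := by
    simp only [hG]
    rw [intervalIntegral.integral_finsetSum, Finset.mul_sum]
    · refine Finset.sum_congr rfl fun e _ => ?_
      rw [intervalIntegral.integral_const_mul]
      ring
    · intro e _
      refine Continuous.intervalIntegrable (continuous_const.mul ?_) _ _
      exact Continuous.const_cpow (by fun_prop) (Or.inl (hx0 e))
  rw [e1, e2, norm_mul, norm_mul, mul_left_comm]
  refine mul_le_mul_of_nonneg_left ?_ (norm_nonneg _)
  have hTT : -T ≤ T := by linarith
  rw [intervalIntegral.integral_ofReal, Complex.norm_real, Real.norm_of_nonneg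
    (intervalIntegral.integral_nonneg hTT fun t _ => hG0 t), ← intervalIntegral.integral_const_mul]
  refine intervalIntegral.norm_integral_le_of_norm_le hTT (Eventually.of_forall fun t _ => ?_)
    ((hGr.const_smul C).intervalIntegrable _ _)
  rw [norm_mul, Complex.norm_real, Real.norm_of_nonneg (hG0 t)]
  exact mul_le_mul_of_nonneg_right (h _ (by simpa using hκ)).2 (hG0 t)

/-! ### Khinchine's inequality and lower bounds for multilinear forms -/

/-- Fourth moment over one random sign; the two sides differ by `8 (im (x * conj y)) ^ 2`. -/
theorem norm_add_pow_four_add_norm_sub_pow_four_le (x y : ℂ) :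
    ‖x + y‖ ^ 4 + ‖x - y‖ ^ 4 ≤ 2 * ‖x‖ ^ 4 + 12 * (‖x‖ ^ 2 * ‖y‖ ^ 2) + 2 * ‖y‖ ^ 4 := by
  have h (z : ℂ) : ‖z‖ ^ 4 = (z.re ^ 2 + z.im ^ 2) ^ 2 := by
    rw [← Complex.normSq_add_mul_I, Complex.re_add_im, Complex.normSq_eq_norm_sq]; ring
  have h2 (z : ℂ) : ‖z‖ ^ 2 = z.re ^ 2 + z.im ^ 2 := by
    rw [← Complex.normSq_add_mul_I, Complex.re_add_im, Complex.normSq_eq_norm_sq]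
  simp only [h, h2, Complex.add_re, Complex.add_im, Complex.sub_re, Complex.sub_im]
  nlinarith [sq_nonneg (x.re * y.im - x.im * y.re)]

/-- Signs for which a combination of second and fourth powers of sums is at least what
independent random signs give on average. -/
theorem exists_signs_sum_sq_sub_pow_four_ge {ι κ : Type*} [Fintype κ] (s : Finset ι)
    (v : κ → ι → ℂ) (a b : κ → ℝ) (hb : ∀ k, 0 ≤ b k) (x : κ → ℂ) :
    ∃ ε : ι → ℂ, (∀ i, ‖ε i‖ ≤ 1) ∧
      ∑ k, (a k * (‖x k‖ ^ 2 + ∑ i ∈ s, ‖v k i‖ ^ 2) -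
        b k * (‖x k‖ ^ 4 + 6 * (‖x k‖ ^ 2 * ∑ i ∈ s, ‖v k i‖ ^ 2) +
          3 * (∑ i ∈ s, ‖v k i‖ ^ 2) ^ 2)) ≤
      ∑ k, (a k * ‖x k + ∑ i ∈ s, ε i * v k i‖ ^ 2 -
        b k * ‖x k + ∑ i ∈ s, ε i * v k i‖ ^ 4) := by
  classical
  induction s using Finset.induction_on generalizing x with
  | empty => exact ⟨fun _ => 1, by simp, by simp⟩
  | insert j s hj ih =>
    set Q : κ → ℝ := fun k => ∑ i ∈ s, ‖v k i‖ ^ 2 with hQ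
    have hQ0 : ∀ k, 0 ≤ Q k := fun k => Finset.sum_nonneg fun i _ => by positivity
    -- Derandomization: `Φ y` bounds from below the expectation over the signs in `s` when the
    -- partial sums are `y`. The two choices of the sign at `j` average to at least `Ψ`, so one of
    -- them reaches it. Second moments are exact; fourth moments are only bounded above, hence `0 ≤
    -- b k`.
    let Φ : (κ → ℂ) → ℝ := fun y => ∑ k, (a k * (‖y k‖ ^ 2 + Q k) -
        b k * (‖y k‖ ^ 4 + 6 * (‖y k‖ ^ 2 * Q k) + 3 * (Q k) ^ 2))
    let Ψ : ℝ := ∑ k, (a k * (‖x k‖ ^ 2 + (‖v k j‖ ^ 2 + Q k)) -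
        b k * (‖x k‖ ^ 4 + 6 * (‖x k‖ ^ 2 * (‖v k j‖ ^ 2 + Q k)) +
          3 * (‖v k j‖ ^ 2 + Q k) ^ 2))
    have key : 2 * Ψ ≤ Φ (fun k => x k + 1 * v k j) + Φ (fun k => x k + (-1) * v k j) := by
      simp only [Φ, Ψ]
      rw [Finset.mul_sum, ← Finset.sum_add_distrib]
      refine Finset.sum_le_sum fun k _ => ?_
      have h4 := norm_add_pow_four_add_norm_sub_pow_four_le (x k) (v k j)
      have h2 := parallelogram_law_with_norm ℝ (x k) (v k j)
      rw [one_mul, neg_one_mul, ← sub_eq_add_neg]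
      have h2' : ‖x k - v k j‖ ^ 2 = 2 * (‖x k‖ ^ 2 + ‖v k j‖ ^ 2) - ‖x k + v k j‖ ^ 2 := by
        linarith
      rw [h2']
      have h5 := mul_le_mul_of_nonneg_left h4 (hb k)
      have h6 : 0 ≤ b k * ‖v k j‖ ^ 4 := mul_nonneg (hb k) (by positivity)
      nlinarith
    have : ∃ e : ℂ, ‖e‖ ≤ 1 ∧ Ψ ≤ Φ (fun k => x k + e * v k j) := by
      by_cases h : Ψ ≤ Φ (fun k => x k + 1 * v k j)
      · exact ⟨1, by simp, h⟩
      · exact ⟨-1, by simp, by linarith⟩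
    obtain ⟨e, he, hΨ⟩ := this
    obtain ⟨ε, hε, h⟩ := ih (fun k => x k + e * v k j)
    refine ⟨Function.update ε j e, fun i => ?_, ?_⟩
    · by_cases hi : i = j
      · subst hi; simpa using he
      · simpa [hi] using hε i
    · have hs : ∀ k, ∑ i ∈ insert j s, Function.update ε j e i * v k i
          = e * v k j + ∑ i ∈ s, ε i * v k i := by
        intro k
        rw [Finset.sum_insert hj, Function.update_self]
        congr 1
        refine Finset.sum_congr rfl fun i hi => ?_
        rw [Function.update_of_ne (by rintro rfl; exact hj hi)]
      simp only [hs, Finset.sum_insert hj, ← add_assoc]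
      refine le_trans ?_ h
      simpa only [Ψ, Φ, ← add_assoc] using hΨ

/-- With `t = y / √Q` this is `t - t ^ 3 / 4 ≤ 1` multiplied by `y`. It minorizes `y` by a
polynomial in `y ^ 2` whose value at the moments `Q` and `3 * Q ^ 2` is `√Q - 3 √Q / 4 = √Q / 4`,
the source of the Khinchine constant. -/
theorem sqrt_inv_mul_sub_le {Q y : ℝ} (hQ : 0 < Q) (hy : 0 ≤ y) :
    (Real.sqrt Q)⁻¹ * y ^ 2 - ((Real.sqrt Q)⁻¹) ^ 3 / 4 * y ^ 4 ≤ y := by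
  set u := (Real.sqrt Q)⁻¹
  have hu : 0 ≤ u := by positivity
  have h : u * y - (u * y) ^ 3 / 4 ≤ 1 := by
    have := mul_nonneg hu hy
    nlinarith [mul_nonneg this (sq_nonneg (u * y - 1)), sq_nonneg (u * y - 1)]
  nlinarith

/-- The Khinchine inequality, for several sums at once. -/
theorem exists_signs_sum_norm_ge {ι κ : Type*} [Fintype ι] [Fintype κ] (v : κ → ι → ℂ) :
    ∃ ε : ι → ℂ, (∀ i, ‖ε i‖ ≤ 1) ∧
      1 / 4 * ∑ k, Real.sqrt (∑ i, ‖v k i‖ ^ 2) ≤ ∑ k, ‖∑ i, ε i * v k i‖ := by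
  let Q : κ → ℝ := fun k => ∑ i, ‖v k i‖ ^ 2
  have hQ0 : ∀ k, 0 ≤ Q k := fun k => Finset.sum_nonneg fun i _ => by positivity
  obtain ⟨ε, hε, h⟩ := exists_signs_sum_sq_sub_pow_four_ge Finset.univ v
    (fun k => (Real.sqrt (Q k))⁻¹) (fun k => ((Real.sqrt (Q k))⁻¹) ^ 3 / 4)
    (fun k => by positivity) 0
  refine ⟨ε, hε, ?_⟩
  rw [Finset.mul_sum]
  refine le_trans (Finset.sum_le_sum fun k _ => ?_) (h.trans (Finset.sum_le_sum fun k _ => ?_))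
  · change _ ≤ (Real.sqrt (Q k))⁻¹ * (‖(0 : κ → ℂ) k‖ ^ 2 + Q k) - ((Real.sqrt (Q k))⁻¹) ^ 3 / 4 *
      (‖(0 : κ → ℂ) k‖ ^ 4 + 6 * (‖(0 : κ → ℂ) k‖ ^ 2 * Q k) + 3 * Q k ^ 2)
    change 1 / 4 * Real.sqrt (Q k) ≤ _
    rcases (hQ0 k).eq_or_lt with h0 | h0
    · simp [← h0]
    · obtain ⟨q, hq, hqQ⟩ : ∃ q : ℝ, 0 < q ∧ q ^ 2 = Q k :=
        ⟨Real.sqrt (Q k), Real.sqrt_pos.2 h0, Real.sq_sqrt h0.le⟩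
      rw [← hqQ, Real.sqrt_sq hq.le]
      simp only [Pi.zero_apply, norm_zero]
      apply le_of_eq
      field_simp
      ring
  · rcases (hQ0 k).eq_or_lt with h0 | h0
    · simp [← h0]
    · simpa using sqrt_inv_mul_sub_le h0 (norm_nonneg (∑ i, ε i * v k i))

/-- Variables are removed one at a time: the first joins the parameter set `κ` for the inductive
step, and is then summed with signs. The weights must serve all `k` at once, which is why Khinchine
is needed for several sums simultaneously. -/
theorem exists_unit_weights_sum_norm_ge {m : ℕ} (r : Fin m → ℕ) {κ : Type} [Fintype κ]
    (c : κ → ((j : Fin m) → Fin (r j)) → ℂ) (hc : ∀ k i, ‖c k i‖ = 1) :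
    ∃ w : (j : Fin m) → Fin (r j) → ℂ, (∀ j x, ‖w j x‖ ≤ 1) ∧
      (1 / 4) ^ m * (Fintype.card κ * ∏ j, Real.sqrt (r j)) ≤
        ∑ k, ‖∑ i, c k i * ∏ j, w j (i j)‖ := by
  induction m generalizing κ with
  | zero =>
    refine ⟨fun j => j.elim0, fun j => j.elim0, ?_⟩
    simp [hc]
  | succ m ih =>
    obtain ⟨w, hw, h⟩ := ih (fun j => r j.succ) (κ := κ × Fin (r 0))
      (fun q i => c q.1 (Fin.cons q.2 i)) (fun q i => hc _ _)
    let Y : κ → Fin (r 0) → ℂ := fun k x =>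
      ∑ i : (j : Fin m) → Fin (r j.succ), c k (Fin.cons x i) * ∏ j, w j (i j)
    obtain ⟨ε, hε, h'⟩ := exists_signs_sum_norm_ge Y
    refine ⟨Fin.cons ε w, fun j => ?_, ?_⟩
    · refine Fin.cases (fun x => ?_) (fun j x => ?_) j
      · simpa using hε x
      · simpa using hw j x
    · have hsum : ∀ k, ∑ i, c k i * ∏ j, (Fin.cons ε w : (j : Fin (m + 1)) → Fin (r j) → ℂ) j (i j)
          = ∑ x, ε x * Y k x := by
        intro k
        rw [← (Fin.consEquiv fun j => Fin (r j)).sum_comp, Fintype.sum_prod_type]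
        refine Finset.sum_congr rfl fun x _ => ?_
        simp only [Y, Finset.mul_sum]
        refine Finset.sum_congr rfl fun i _ => ?_
        rw [show (Fin.consEquiv fun j => Fin (r j)) (x, i) = Fin.cons x i from rfl]
        simp only [Fin.prod_univ_succ, Fin.cons_zero, Fin.cons_succ]
        ring
      simp only [hsum]
      refine le_trans ?_ h'
      -- Cauchy–Schwarz passes from the `ℓ¹` sum given by induction to the `ℓ²` norm in Khinchine;
      -- this turns the factor `r 0` into `√(r 0)`.
      have hCS : ∀ k, ∑ x, ‖Y k x‖ ≤ Real.sqrt (r 0) * Real.sqrt (∑ x, ‖Y k x‖ ^ 2) := by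
        intro k
        rw [← Real.sqrt_mul (by positivity)]
        apply Real.le_sqrt_of_sq_le
        simpa using sq_sum_le_card_mul_sum_sq (s := Finset.univ) (f := fun x => ‖Y k x‖)
      rw [Fintype.sum_prod_type] at h
      have h2 := h.trans (Finset.sum_le_sum fun k _ => hCS k)
      rw [← Finset.mul_sum] at h2
      rw [Fin.prod_univ_succ, pow_succ]
      rw [Fintype.card_prod, Fintype.card_fin] at h2
      push_cast at h2
      set S := ∑ k, Real.sqrt (∑ x, ‖Y k x‖ ^ 2)
      set P := ∏ j : Fin m, Real.sqrt (r j.succ)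
      rcases Nat.eq_zero_or_pos (r 0) with h0 | h0
      · have : 0 ≤ S := Finset.sum_nonneg fun _ _ => by positivity
        simp only [h0, Nat.cast_zero, Real.sqrt_zero]
        simpa using this
      · obtain ⟨q, hq, hqr⟩ : ∃ q : ℝ, 0 < q ∧ q ^ 2 = (r 0 : ℝ) :=
          ⟨Real.sqrt (r 0), by positivity, Real.sq_sqrt (by positivity)⟩
        rw [← hqr, Real.sqrt_sq hq.le] at h2 ⊢
        have h3 : q * ((1 / 4) ^ m * (Fintype.card κ * (q * P))) ≤ q * S := by
          refine le_trans (le_of_eq ?_) h2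
          ring
        have h4 := le_of_mul_le_mul_left h3 hq
        linarith

/-- A multilinear form with unimodular coefficients is large somewhere on the polydisc. -/
theorem exists_unit_weights_norm_sum_ge {m : ℕ} (r : Fin (m + 1) → ℕ)
    (c : ((j : Fin (m + 1)) → Fin (r j)) → ℂ) (hc : ∀ i, ‖c i‖ = 1) :
    ∃ w : (j : Fin (m + 1)) → Fin (r j) → ℂ, (∀ j x, ‖w j x‖ ≤ 1) ∧
      (1 / 4) ^ m * (r (Fin.last m) * ∏ j : Fin m, Real.sqrt (r j.castSucc)) ≤
        ‖∑ i, c i * ∏ j, w j (i j)‖ := by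
  obtain ⟨w, hw, h⟩ := exists_unit_weights_sum_norm_ge (fun j => r (Fin.castSucc j))
    (κ := Fin (r (Fin.last m))) (fun k i => c (Fin.snoc i k)) (fun k i => hc _)
  let Y : Fin (r (Fin.last m)) → ℂ := fun k =>
      ∑ i : (j : Fin m) → Fin (r j.castSucc), c (Fin.snoc i k) * ∏ j, w j (i j)
  -- The phases align all `Y k`, so the last variable loses nothing and contributes `r (Fin.last m)`
  -- in full. Where `Y k = 0`, division by zero gives the harmless weight 0.
  let e : Fin (r (Fin.last m)) → ℂ := fun k => (starRingEnd ℂ) (Y k) / ‖Y k‖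
  have he : ∀ k, ‖e k‖ ≤ 1 := by
    intro k
    simp only [e, norm_div, RCLike.norm_conj, Complex.norm_real, norm_norm]
    exact div_self_le_one _
  have heY : ∀ k, e k * Y k = (‖Y k‖ : ℂ) := by
    intro k
    simp only [e]
    by_cases h0 : Y k = 0
    · simp [h0]
    · have : (‖Y k‖ : ℂ) ≠ 0 := by simpa using h0
      rw [div_mul_eq_mul_div, mul_comm, Complex.mul_conj, Complex.normSq_eq_norm_sq]
      field_simp
      push_cast
      ring
  refine ⟨Fin.snoc w e, fun j => ?_, ?_⟩
  · refine Fin.lastCases (fun x => ?_) (fun j x => ?_) j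
    · simpa using he x
    · simpa using hw j x
  · have hsum : ∑ i, c i * ∏ j, (Fin.snoc w e : (j : Fin (m + 1)) → Fin (r j) → ℂ) j (i j)
        = ∑ k, e k * Y k := by
      rw [← (Fin.snocEquiv fun j => Fin (r j)).sum_comp, Fintype.sum_prod_type]
      refine Finset.sum_congr rfl fun x _ => ?_
      simp only [Y, Finset.mul_sum]
      refine Finset.sum_congr rfl fun i _ => ?_
      rw [show (Fin.snocEquiv fun j => Fin (r j)) (x, i) = Fin.snoc i x from rfl]
      simp only [Fin.prod_univ_castSucc, Fin.snoc_last, Fin.snoc_castSucc]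
      ring
    rw [hsum]
    simp only [heY]
    rw [← Complex.ofReal_sum, Complex.norm_real,
      Real.norm_of_nonneg (Finset.sum_nonneg fun _ _ => norm_nonneg _)]
    simpa using h

/-! ### Riesz products over primes -/

/-- The coefficient of `p ^ (s * t * I)` in `1 + re (z * p ^ (t * I))`. -/
noncomputable def rieszWeight (z : ℂ) : SignType → ℂ
  | 0 => 1
  | 1 => z / 2
  | -1 => (starRingEnd ℂ) z / 2

/-- The rational number with exponents `e` at the primes `p`. -/
def signedProduct {Q : Type*} [Fintype Q] (p : Q → ℕ) (e : Q → SignType) : ℚ :=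
  ∏ q, (p q : ℚ) ^ (e q : ℤ)

theorem padicValRat_prod_zpow {Q : Type*} [DecidableEq Q] (p : Q → ℕ) (hp : ∀ q, (p q).Prime)
    (e : Q → ℤ) (s : Finset Q) (l : ℕ) [hl : Fact l.Prime] :
    padicValRat l (∏ q ∈ s, (p q : ℚ) ^ e q) = ∑ q ∈ s, if p q = l then e q else 0 := by
  induction s using Finset.induction_on with
  | empty => simp
  | insert q s hq ih =>
    have h0 : ∀ q, (p q : ℚ) ^ e q ≠ 0 := fun q =>
      zpow_ne_zero _ (by exact_mod_cast (hp q).ne_zero)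
    rw [Finset.prod_insert hq, Finset.sum_insert hq,
      padicValRat.mul (h0 q) (Finset.prod_ne_zero_iff.2 fun q _ => h0 q), ih]
    congr 1
    rw [padicValRat.zpow]
    split_ifs with h
    · rw [h, padicValRat.self hl.out.one_lt, mul_one]
    · rw [padicValRat.of_nat, padicValNat.eq_zero_of_not_dvd]
      · simp
      · rw [Nat.prime_dvd_prime_iff_eq hl.out (hp q)]
        exact fun h' => h h'.symm

section signedProduct

variable {Q : Type*} [Fintype Q] {p : Q → ℕ}

/-- The valuation at `p q` recovers `e q`. Thus distinct terms of an expanded Riesz product have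
distinct frequencies. -/
theorem signedProduct_injective (hp : ∀ q, (p q).Prime) (hinj : Function.Injective p) :
    Function.Injective (signedProduct p) := by
  classical
  intro e e' h
  funext q
  have : Fact (p q).Prime := ⟨hp q⟩
  have h' := congrArg (padicValRat (p q)) h
  unfold signedProduct at h'
  rw [padicValRat_prod_zpow p hp, padicValRat_prod_zpow p hp] at h'
  simp only [hinj.eq_iff, Finset.sum_ite_eq', Finset.mem_univ, if_true] at h'
  revert h'
  generalize e q = x
  generalize e' q = y
  revert x y
  decide

theorem exists_eq_of_prime_dvd_of_eq_signedProduct (hp : ∀ q, (p q).Prime) {e : Q → SignType}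
    {n l : ℕ} (hn : n ≠ 0) (hl : l.Prime) (hln : l ∣ n) (h : (n : ℚ) = signedProduct p e) :
    ∃ q, p q = l := by
  classical
  by_contra! hc
  have : Fact l.Prime := ⟨hl⟩
  have h' := congrArg (padicValRat l) h
  unfold signedProduct at h'
  rw [padicValRat_prod_zpow p hp, padicValRat.of_nat] at h'
  simp only [hc, if_false, Finset.sum_const_zero, Nat.cast_eq_zero] at h'
  have := one_le_padicValNat_of_dvd hn hln
  omega

theorem signedProduct_pos (hp : ∀ q, (p q).Prime) (e : Q → SignType) : 0 < signedProduct p e :=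
  Finset.prod_pos fun q _ => zpow_pos (by exact_mod_cast (hp q).pos) _

theorem ofReal_prod_cpow {ι : Type*} (s : Finset ι) (x : ι → ℝ) (hx : ∀ i, 0 ≤ x i) (w : ℂ) :
    ((∏ i ∈ s, x i : ℝ) : ℂ) ^ w = ∏ i ∈ s, (x i : ℂ) ^ w := by
  classical
  induction s using Finset.induction_on with
  | empty => simp
  | insert i s hi ih =>
    rw [Finset.prod_insert hi, Finset.prod_insert hi, ← ih, Complex.ofReal_mul,
      Complex.mul_cpow_ofReal_nonneg (hx i) (Finset.prod_nonneg fun i _ => hx i)]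

/-- `re w = (w + conj w) / 2`, and conjugating `l ^ (i t)` replaces `l` by `l⁻¹`. -/
theorem ofReal_one_add_re_mul_cpow {l : ℕ} (hl : 0 < l) (z : ℂ) (t : ℝ) :
    ((1 + (z * (l : ℂ) ^ (t * Complex.I)).re : ℝ) : ℂ) =
      ∑ s : SignType, rieszWeight z s * (((l : ℝ) ^ (s : ℤ) : ℝ) : ℂ) ^ (t * Complex.I) := by
  have hl0 : (l : ℂ) ≠ 0 := by exact_mod_cast hl.ne'
  have huniv : (Finset.univ : Finset SignType) = {0, -1, 1} := rfl
  have hinv : (((l : ℝ)⁻¹ : ℝ) : ℂ) ^ (t * Complex.I) =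
      (starRingEnd ℂ) ((l : ℂ) ^ (t * Complex.I)) := by
    rw [Complex.ofReal_inv, Complex.ofReal_natCast, Complex.inv_cpow _ _
      (by rw [Complex.natCast_arg]; exact Real.pi_ne_zero.symm), ← Complex.cpow_neg,
      show -(t * Complex.I : ℂ) = (starRingEnd ℂ) (t * Complex.I) by simp,
      Complex.cpow_conj _ _ (by rw [Complex.natCast_arg]; exact Real.pi_ne_zero.symm)]
    simp
  rw [huniv, Finset.sum_insert (by decide), Finset.sum_insert (by decide), Finset.sum_singleton]
  rw [show rieszWeight z 0 = 1 from rfl, show rieszWeight z 1 = z / 2 from rfl,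
    show rieszWeight z (-1) = (starRingEnd ℂ) z / 2 from rfl,
    show ((0 : SignType) : ℤ) = 0 from rfl, show ((1 : SignType) : ℤ) = 1 from rfl,
    show ((-1 : SignType) : ℤ) = -1 from rfl, zpow_zero, zpow_one, zpow_neg_one, hinv]
  rw [Complex.ofReal_add, Complex.re_eq_add_conj, map_mul]
  simp
  ring

/-- A bounded Dirichlet series tested against a Riesz product. -/
theorem norm_sum_rieszWeight_le {a : ℕ → ℂ} (ha : a 0 = 0) {σ C : ℝ} {f : ℂ → ℂ}
    (h : ∀ s : ℂ, σ < s.re →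
      Tendsto (fun N : ℕ => ∑ n ∈ Finset.Icc 1 N, a n * (n : ℂ) ^ (-s)) atTop (𝓝 (f s)) ∧
        ‖f s‖ ≤ C) {κ : ℝ} (hκ : σ < κ) (hp : ∀ q, (p q).Prime) (hinj : Function.Injective p)
    (z : Q → ℂ) (hz : ∀ q, ‖z q‖ ≤ 1) [DecidableEq Q] :
    ‖∑ e : Q → SignType, (∏ q, rieszWeight (z q) (e q)) *
      (((signedProduct p e : ℝ) : ℂ) ^ (-(κ : ℂ)) *
        ∑' n : ℕ, if (n : ℝ) = (signedProduct p e : ℝ) then a n else 0)‖ ≤ C := by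
  have key := norm_sum_mul_tsum_le_of_nonneg ha h hκ
    (fun e : Q → SignType => ∏ q, rieszWeight (z q) (e q)) (fun e => (signedProduct p e : ℝ))
    (fun e => by exact_mod_cast signedProduct_pos hp e)
    -- Every factor is nonnegative because `‖z q‖ ≤ 1`.
    (fun t => ∏ q, (1 + (z q * (p q : ℂ) ^ (t * Complex.I)).re))
    (fun t => Finset.prod_nonneg fun q _ => by
      have h1 := (abs_le.1 (Complex.abs_re_le_norm (z q * (p q : ℂ) ^ (t * Complex.I)))).1
      rw [norm_mul, Complex.norm_natCast_cpow_of_pos (hp q).pos] at h1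
      simp at h1
      have := hz q
      simp
      linarith)
    (fun t => by
      rw [Complex.ofReal_prod]
      simp only [ofReal_one_add_re_mul_cpow (hp _).pos]
      rw [Finset.prod_univ_sum, Fintype.piFinset_univ]
      refine Finset.sum_congr rfl fun e _ => ?_
      rw [Finset.prod_mul_distrib]
      congr 1
      rw [signedProduct, ← ofReal_prod_cpow _ _ (fun q => by positivity)]
      push_cast
      rfl)
  refine key.trans (le_of_eq ?_)
  -- Only `e = 0` has frequency 1, so the Riesz product has mean 1.
  have h1 : ∀ e : Q → SignType, ((signedProduct p e : ℚ) : ℝ) = 1 ↔ e = 0 := by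
    intro e
    have h0 : signedProduct p 0 = 1 := by simp [signedProduct]
    rw [← (signedProduct_injective hp hinj).eq_iff, h0]
    exact_mod_cast Iff.rfl
  simp only [h1]
  simp [show ∀ z, rieszWeight z 0 = 1 from fun _ => rfl]

end signedProduct

/-! ### The block of level `L` -/

namespace DirichletWalsh

variable {M : ℕ} {ρ : Fin M → ℝ} {L : ℕ}

/-- The primes that occur at level `L`. -/
noncomputable def levelPrime (ρ : Fin M → ℝ) (L : ℕ) (q : (j : Fin M) × Fin (size ρ L j)) : ℕ :=
  kthPrime ((M + (q.1 : ℕ)) * 2 ^ L + (q.2 : ℕ))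

/-- The exponents of the primes of level `L` in the integer of a multi-index. -/
noncomputable def exponents (i : MultiIndex ρ L) (q : (j : Fin M) × Fin (size ρ L j)) : SignType :=
  if q.2 = i q.1 then 1 else 0

theorem levelPrime_prime (q : (j : Fin M) × Fin (size ρ L j)) : (levelPrime ρ L q).Prime :=
  kthPrime_prime _

theorem one_le_mul_two_pow_add (j : Fin M) (x : ℕ) : 1 ≤ (M + (j : ℕ)) * 2 ^ L + x := by
  have := j.pos
  have : 0 < (M + (j : ℕ)) * 2 ^ L := by positivity
  omega

theorem levelPrime_injective (hρ : ∀ j, ρ j ≤ 1) : Function.Injective (levelPrime ρ L) := by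
  rintro ⟨j, x⟩ ⟨j', x'⟩ h
  have h1 := kthPrime_inj (one_le_mul_two_pow_add _ _) (one_le_mul_two_pow_add _ _) h
  simp only at h1
  have hx := x.2.trans_le (size_le hρ L j)
  have hx' := x'.2.trans_le (size_le hρ L j')
  have hj : (j : ℕ) = j' := by
    have e1 : ((M + (j : ℕ)) * 2 ^ L + (x : ℕ)) / 2 ^ L = M + j := by
      rw [mul_comm, Nat.mul_add_div (by positivity), Nat.div_eq_of_lt hx, add_zero]
    have e2 : ((M + (j' : ℕ)) * 2 ^ L + (x' : ℕ)) / 2 ^ L = M + j' := by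
      rw [mul_comm, Nat.mul_add_div (by positivity), Nat.div_eq_of_lt hx', add_zero]
    rw [h1, e2] at e1
    omega
  obtain rfl := Fin.ext hj
  obtain rfl : x = x' := Fin.ext (by omega)
  rfl

theorem exponents_injective : Function.Injective (exponents : MultiIndex ρ L → _) := by
  intro i i' h
  funext j
  have h1 := congrFun h ⟨j, i j⟩
  by_contra hc
  simp [exponents, hc] at h1

theorem signedProduct_exponents (i : MultiIndex ρ L) :
    signedProduct (levelPrime ρ L) (exponents i) = primeProduct ρ L i := by
  unfold signedProduct primeProduct
  rw [Fintype.prod_sigma]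
  push_cast
  refine Finset.prod_congr rfl fun j _ => ?_
  rw [Finset.prod_eq_single (i j)]
  · simp [exponents, levelPrime, primeIndex]
  · intro x _ hx
    simp [exponents, hx]
  · simp

theorem prod_rieszWeight_exponents (i : MultiIndex ρ L)
    (z : (j : Fin M) → Fin (size ρ L j) → ℂ) :
    ∏ q, rieszWeight (z q.1 q.2) (exponents i q) = ∏ j, (z j (i j) / 2) := by
  rw [Fintype.prod_sigma]
  refine Finset.prod_congr rfl fun j _ => ?_
  rw [Finset.prod_eq_single (i j)]
  · simp only [exponents, if_true]; rfl
  · intro x _ hx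
    simp only [exponents, hx, if_false]; rfl
  · simp

theorem primeProduct_ne_zero (i : MultiIndex ρ L) : primeProduct ρ L i ≠ 0 :=
  Finset.prod_ne_zero_iff.2 fun _ _ => (kthPrime_prime _).ne_zero

/-- A nonzero coefficient would make `n` the integer of a multi-index at some level `L'`. A prime
factor of it is then also a prime of level `L`; the index ranges force `L' = L`, and unique
factorization makes `e` the exponents of that multi-index. -/
theorem coeff_eq_zero_of_forall_exponents_ne (hM : 1 ≤ M) (hρ : ∀ j, ρ j ≤ 1) (X : ℝ) (β : ℕ → ℂ)
    {e : (j : Fin M) × Fin (size ρ L j) → SignType} (he : ∀ i, exponents i ≠ e) {n : ℕ}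
    (hn : (n : ℚ) = signedProduct (levelPrime ρ L) e) : coeff ρ X β n = 0 := by
  refine coeff_eq_zero ρ X β fun L' _ i' h => ?_
  subst h
  obtain ⟨⟨j, x⟩, hq⟩ := exists_eq_of_prime_dvd_of_eq_signedProduct levelPrime_prime
    (primeProduct_ne_zero i') (kthPrime_prime _)
    (Finset.dvd_prod_of_mem _ (Finset.mem_univ (⟨0, hM⟩ : Fin M))) hn
  have h1 := kthPrime_inj (one_le_mul_two_pow_add _ _) (one_le_mul_two_pow_add _ _) hq
  have hL : L = L' := le_antisymm
    (level_le hM ((i' ⟨0, hM⟩).2.trans_le (size_le hρ L' _)) h1.symm)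
    (level_le j.2 (x.2.trans_le (size_le hρ L j)) h1)
  subst hL
  rw [← signedProduct_exponents] at hn
  exact he i' (signedProduct_injective levelPrime_prime (levelPrime_injective hρ) hn)

theorem norm_sum_coeff_primeProduct_le (hM : 1 ≤ M) (hρ : ∀ j, ρ j ≤ 1) (X : ℝ) (β : ℕ → ℂ)
    {σ C : ℝ} {f : ℂ → ℂ}
    (h : ∀ s : ℂ, σ < s.re →
      Tendsto (fun N : ℕ => ∑ n ∈ Finset.Icc 1 N, coeff ρ X β n * (n : ℂ) ^ (-s)) atTop (𝓝 (f s)) ∧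
        ‖f s‖ ≤ C) {κ : ℝ} (hκ : σ < κ)
    (z : (j : Fin M) → Fin (size ρ L j) → ℂ) (hz : ∀ j x, ‖z j x‖ ≤ 1) :
    ‖∑ i : MultiIndex ρ L, (∏ j, (z j (i j) / 2)) *
      ((primeProduct ρ L i : ℂ) ^ (-(κ : ℂ)) * coeff ρ X β (primeProduct ρ L i))‖ ≤ C := by
  have h0 : coeff ρ X β 0 = 0 := coeff_eq_zero ρ X β fun _ _ i => primeProduct_ne_zero i
  refine le_trans (le_of_eq ?_) (norm_sum_rieszWeight_le h0 h hκ levelPrime_prime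
    (levelPrime_injective (L := L) hρ) (fun q => z q.1 q.2) (fun q => hz _ _))
  congr 1
  refine Finset.sum_of_injOn exponents exponents_injective.injOn (by simp) ?_ ?_
  · intro e _ he
    have : ∀ n : ℕ, (if (n : ℝ) = (signedProduct (levelPrime ρ L) e : ℝ) then
        coeff ρ X β n else 0) = 0 := by
      intro n
      split_ifs with hn
      · exact coeff_eq_zero_of_forall_exponents_ne hM hρ X β (fun i hi => he ⟨i, by simp, hi⟩)
          (by exact_mod_cast hn)
      · rfl
    simp [this]
  · intro i _
    rw [prod_rieszWeight_exponents, signedProduct_exponents]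
    congr 2
    have : ∀ n : ℕ, ((n : ℝ) = (((primeProduct ρ L i : ℕ) : ℚ) : ℝ)) ↔ n = primeProduct ρ L i := by
      intro n
      norm_cast
    simp only [this, tsum_ite_eq]

theorem norm_walshPhase (i : MultiIndex ρ L) : ‖walshPhase ρ L i‖ = 1 := by
  unfold walshPhase
  rw [norm_prod]
  refine Finset.prod_eq_one fun j _ => ?_
  rw [norm_pow]
  have : ∀ r : ℕ, ‖rootOfUnity r‖ = 1 := by
    intro r
    unfold rootOfUnity
    rw [show (2 * Real.pi * Complex.I / r : ℂ) = ((2 * Real.pi / r : ℝ) : ℂ) * Complex.I by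
      push_cast; ring]
    exact Complex.norm_exp_ofReal_mul_I _
  rw [this, one_pow]

/-- The trivial bound `p_k ≥ k + 1` is enough; no finer information on the size of the primes
enters. -/
theorem two_pow_le_levelPrime (q : (j : Fin M) × Fin (size ρ L j)) :
    2 ^ L ≤ levelPrime ρ L q := by
  have h1 := Nat.add_two_le_nth_prime ((M + (q.1 : ℕ)) * 2 ^ L + (q.2 : ℕ) - 1)
  have h2 : 1 * 2 ^ L ≤ (M + (q.1 : ℕ)) * 2 ^ L :=
    Nat.mul_le_mul_right _ (by have := q.1.pos; omega)
  unfold levelPrime kthPrime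
  omega

theorem norm_sum_walshPhase_mul_le (hM : 1 ≤ M) (hρ : ∀ j, ρ j ≤ 1) (X : ℝ) {β : ℕ → ℂ}
    (hβ : ∀ L, 1 ≤ L → ‖β L‖ = 1) {σ C : ℝ} {f : ℂ → ℂ}
    (h : ∀ s : ℂ, σ < s.re →
      Tendsto (fun N : ℕ => ∑ n ∈ Finset.Icc 1 N, coeff ρ X β n * (n : ℂ) ^ (-s)) atTop (𝓝 (f s)) ∧
        ‖f s‖ ≤ C) {δ : ℝ} (hδ : 0 ≤ δ) (hσ : σ < -δ) (hL : 1 ≤ L)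
    (w : (j : Fin M) → Fin (size ρ L j) → ℂ) (hw : ∀ j x, ‖w j x‖ ≤ 1) :
    ((2 : ℝ) ^ L) ^ (δ * M) * (2 : ℝ) ^ (-(X * L)) *
      ‖∑ i : MultiIndex ρ L, walshPhase ρ L i * ∏ j, w j (i j)‖ ≤ 2 ^ M * C := by
  -- The weights `(2 ^ L / p) ^ δ ≤ 1` replace each factor `p ^ δ` of `n ^ δ` by `2 ^ (L δ)`, so the
  -- power of `n` leaves the sum as a constant. The `2 ^ M` in the bound undoes the halves in the
  -- Riesz weights.
  let y : (j : Fin M) → Fin (size ρ L j) → ℝ := fun j x => 2 ^ L / levelPrime ρ L ⟨j, x⟩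
  have hP : ∀ q, (0 : ℝ) < levelPrime ρ L q := fun q => by
    exact_mod_cast (levelPrime_prime q).pos
  have hy0 : ∀ j x, 0 ≤ y j x := fun j x => div_nonneg (by positivity) (hP _).le
  have hy1 : ∀ j x, y j x ≤ 1 := fun j x => by
    refine div_le_one_of_le₀ ?_ (hP _).le
    exact_mod_cast two_pow_le_levelPrime ⟨j, x⟩
  have key := norm_sum_coeff_primeProduct_le hM hρ X β h hσ (L := L)
    (fun j x => ((y j x ^ δ : ℝ) : ℂ) * w j x) (fun j x => by
      rw [norm_mul, Complex.norm_real, Real.norm_of_nonneg (Real.rpow_nonneg (hy0 j x) _)]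
      exact mul_le_one₀ (Real.rpow_le_one (hy0 j x) (hy1 j x) hδ) (norm_nonneg _) (hw j x))
  have hterm : ∀ i : MultiIndex ρ L, (∏ j, (((y j (i j) ^ δ : ℝ) : ℂ) * w j (i j) / 2)) *
      ((primeProduct ρ L i : ℂ) ^ (-((-δ : ℝ) : ℂ)) * coeff ρ X β (primeProduct ρ L i)) =
      ((1 / 2) ^ M * ((((2 : ℝ) ^ L) ^ (δ * M) * (2 : ℝ) ^ (-(X * L)) : ℝ) : ℂ) * β L) *
        (walshPhase ρ L i * ∏ j, w j (i j)) := by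
    intro i
    rw [coeff_primeProduct hM hρ X β hL]
    have h1 : (primeProduct ρ L i : ℂ) ^ (-((-δ : ℝ) : ℂ)) =
        (((primeProduct ρ L i : ℝ) ^ δ : ℝ) : ℂ) := by
      rw [Complex.ofReal_cpow (by positivity)]
      simp
    have h2 : (∏ j, y j (i j) ^ δ) * (primeProduct ρ L i : ℝ) ^ δ = ((2 : ℝ) ^ L) ^ (δ * M) := by
      rw [Real.finsetProd_rpow _ _ (fun j _ => hy0 j (i j)),
        ← Real.mul_rpow (Finset.prod_nonneg fun j _ => hy0 j (i j)) (by positivity)]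
      have : (∏ j, y j (i j)) * (primeProduct ρ L i : ℝ) = ((2 : ℝ) ^ L) ^ M := by
        unfold primeProduct
        rw [Nat.cast_prod, ← Finset.prod_mul_distrib]
        rw [Finset.prod_congr rfl (g := fun _ => (2 : ℝ) ^ L)]
        · simp
        · intro j _
          exact div_mul_cancel₀ _ (hP ⟨j, i j⟩).ne'
      rw [this, ← Real.rpow_natCast _ M, ← Real.rpow_mul (by positivity), mul_comm]
    rw [h1, ← h2]
    simp only [div_eq_mul_inv, Finset.prod_mul_distrib, Finset.prod_const, Finset.card_univ,
      Fintype.card_fin]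
    push_cast
    ring
  simp only [hterm] at key
  rw [← Finset.mul_sum, norm_mul, norm_mul, norm_mul, hβ L hL, Complex.norm_real,
    Real.norm_of_nonneg (by positivity)] at key
  simp only [norm_pow, norm_div, norm_one, Complex.norm_ofNat, mul_one] at key
  rw [mul_assoc, div_pow, one_pow, one_div, inv_mul_le_iff₀ (by positivity)] at key
  exact key

/-- For `x ≥ 1`, `x < ⌊x⌋ + 1 ≤ 2 ⌊x⌋`. -/
theorem half_le_size (j : Fin M) (hρ0 : 0 ≤ ρ j) : (2 : ℝ) ^ (ρ j * L) / 2 ≤ size ρ L j := by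
  have h1 : (1 : ℝ) ≤ 2 ^ (ρ j * L) := Real.one_le_rpow (by norm_num) (by positivity)
  have h2 : 1 ≤ size ρ L j := Nat.le_floor (by simpa using h1)
  have h2' : (1 : ℝ) ≤ size ρ L j := by exact_mod_cast h2
  have h3 : (2 : ℝ) ^ (ρ j * L) < size ρ L j + 1 := Nat.lt_floor_add_one _
  linarith

theorem half_le_sqrt_size (j : Fin M) (hρ0 : 0 ≤ ρ j) :
    (2 : ℝ) ^ (ρ j * L / 2) / 2 ≤ Real.sqrt (size ρ L j) := by
  apply Real.le_sqrt_of_sq_le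
  refine le_trans ?_ (half_le_size j hρ0)
  rw [div_pow, ← Real.rpow_natCast _ 2, ← Real.rpow_mul (by norm_num)]
  have : (0 : ℝ) < 2 ^ (ρ j * L) := by positivity
  norm_num
  linarith

end DirichletWalsh

/-! ### Comparison of the two bounds -/

theorem mainTheorem3 (M : ℕ) (hM : 1 ≤ M) (ρ : Fin M → ℝ)
    (hρ_mono : Monotone ρ) (hρ_mem : ∀ j, ρ j ∈ Set.Icc (0 : ℝ) 1)
    (hρ_last : ρ ⟨M - 1, by omega⟩ = 1)
    (X : ℝ) (hX : X = (∑ j, ρ j) * (((M : ℝ) + 1) / (2 * (M : ℝ))))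
    (β : ℕ → ℂ) (hβ : ∀ L, 1 ≤ L → ‖β L‖ = 1) :
    0 ≤ DirichletWalsh.sigmaB (DirichletWalsh.coeff ρ X β) := by
  refine le_sInf ?_
  rintro _ ⟨σ, ⟨f, C, h⟩, rfl⟩
  by_contra hσ
  have hσ0 : σ < 0 := by
    rw [not_le] at hσ
    exact_mod_cast hσ
  obtain ⟨m, rfl⟩ : ∃ m, M = m + 1 := ⟨M - 1, by omega⟩
  have hρ1 : ∀ j, ρ j ≤ 1 := fun j => (hρ_mem j).2
  have hlast : ρ (Fin.last m) = 1 := hρ_last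
  set S : ℝ := ∑ j : Fin m, ρ j.castSucc with hS
  -- After clearing denominators this is exactly `S ≤ m`.
  have hXle : X ≤ 1 + S / 2 := by
    have hsum : ∑ j, ρ j = S + 1 := by rw [Fin.sum_univ_castSucc, hlast]
    have hSm : S ≤ m := by
      refine (Finset.sum_le_sum fun j _ => hρ1 j.castSucc).trans ?_
      simp
    rw [hX, hsum, mul_div_assoc', div_le_iff₀ (by positivity)]
    push_cast
    nlinarith
  have hbound : ∀ L : ℕ, 1 ≤ L →
      ((2 : ℝ) ^ (-σ / 2 * (m + 1 : ℕ))) ^ L ≤ 2 ^ (m + 1) * C * 8 ^ m := by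
    intro L hL
    obtain ⟨w, hw, hlow⟩ := exists_unit_weights_norm_sum_ge (DirichletWalsh.size ρ L)
      (DirichletWalsh.walshPhase ρ L) DirichletWalsh.norm_walshPhase
    -- With `δ = -σ / 2` the line `re s = -δ` lies strictly inside the half plane, yet `δ > 0` still
    -- yields exponential growth.
    have hup := DirichletWalsh.norm_sum_walshPhase_mul_le hM hρ1 X hβ h
      (δ := -σ / 2) (by linarith) (by linarith) hL w hw
    have hsl : (DirichletWalsh.size ρ L (Fin.last m) : ℝ) = 2 ^ (L : ℝ) := by
      unfold DirichletWalsh.size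
      rw [hlast, one_mul, Real.rpow_natCast]
      exact_mod_cast Nat.floor_natCast (R := ℝ) (2 ^ L)
    have hprod : (2 : ℝ) ^ (S * L / 2) * (1 / 2) ^ m ≤
        ∏ j : Fin m, Real.sqrt (DirichletWalsh.size ρ L j.castSucc) := by
      have e1 : (2 : ℝ) ^ (S * L / 2) * (1 / 2) ^ m =
          ∏ j : Fin m, ((2 : ℝ) ^ (ρ j.castSucc * L / 2) / 2) := by
        simp only [div_eq_mul_inv _ (2 : ℝ), Finset.prod_mul_distrib]
        rw [← Real.rpow_sum_of_pos (by norm_num), hS, Finset.sum_mul, Finset.sum_mul]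
        simp
      rw [e1]
      exact Finset.prod_le_prod (fun j _ => by positivity)
        fun j _ => DirichletWalsh.half_le_sqrt_size _ (hρ_mem _).1
    -- Each of the first `m` variables costs `1 / 4` from Khinchine and `1 / 2` from the floor; the
    -- last size is exactly `2 ^ L`.
    have hlow' : (1 / 8 : ℝ) ^ m * (2 : ℝ) ^ (X * L) ≤
        ‖∑ i, DirichletWalsh.walshPhase ρ L i * ∏ j, w j (i j)‖ := by
      refine le_trans ?_ hlow
      rw [hsl]
      have e2 : (2 : ℝ) ^ (X * L) ≤ 2 ^ (L : ℝ) * 2 ^ (S * L / 2) := by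
        rw [← Real.rpow_add (by norm_num)]
        refine Real.rpow_le_rpow_of_exponent_le (by norm_num) ?_
        have := mul_le_mul_of_nonneg_right hXle (Nat.cast_nonneg (α := ℝ) L)
        linarith
      calc (1 / 8 : ℝ) ^ m * (2 : ℝ) ^ (X * L)
          ≤ (1 / 8 : ℝ) ^ m * (2 ^ (L : ℝ) * 2 ^ (S * L / 2)) := by gcongr
        _ = (1 / 4) ^ m * (2 ^ (L : ℝ) * (2 ^ (S * L / 2) * (1 / 2) ^ m)) := by
            rw [show (1 / 8 : ℝ) = 1 / 4 * (1 / 2) by norm_num, mul_pow]; ring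
        _ ≤ _ := by gcongr
    have e3 : ((2 : ℝ) ^ L) ^ (-σ / 2 * (m + 1 : ℕ)) = ((2 : ℝ) ^ (-σ / 2 * (m + 1 : ℕ))) ^ L := by
      rw [← Real.rpow_natCast, ← Real.rpow_natCast, ← Real.rpow_mul (by norm_num),
        ← Real.rpow_mul (by norm_num), mul_comm]
    rw [e3] at hup
    set t : ℝ := ((2 : ℝ) ^ (-σ / 2 * (m + 1 : ℕ))) ^ L
    have ht : 0 ≤ t := by positivity
    have hx : (2 : ℝ) ^ (-(X * L)) * 2 ^ (X * L) = 1 := by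
      rw [← Real.rpow_add (by norm_num)]; simp
    have h8 : (1 / 8 : ℝ) ^ m * 8 ^ m = 1 := by rw [← mul_pow]; norm_num
    calc t = t * (2 : ℝ) ^ (-(X * L)) * ((1 / 8) ^ m * 2 ^ (X * L)) * 8 ^ m := by
          linear_combination (-t) * hx - t * (2 : ℝ) ^ (-(X * L)) * 2 ^ (X * L) * h8
      _ ≤ t * (2 : ℝ) ^ (-(X * L)) *
          ‖∑ i, DirichletWalsh.walshPhase ρ L i * ∏ j, w j (i j)‖ * 8 ^ m := by gcongr
      _ ≤ 2 ^ (m + 1) * C * 8 ^ m := by gcongr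
  have hgt : (1 : ℝ) < 2 ^ (-σ / 2 * (m + 1 : ℕ)) := by
    refine Real.one_lt_rpow (by norm_num) (mul_pos (by linarith) (by positivity))
  obtain ⟨L, hL⟩ := pow_unbounded_of_one_lt (2 ^ (m + 1) * C * 8 ^ m) hgt
  -- The shift to `L + 1` guards against `L = 0`, where the bound is not available.
  have h1 := hbound (L + 1) (by omega)
  have h2 := pow_le_pow_right₀ hgt.le (Nat.le_succ L)
  exact absurd (hL.trans_le (h2.trans h1)) (lt_irrefl _)
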